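/- Let $\alpha\in[0,1]$ and let $m\ge 1$ be an integer. Let $(G_n)_{n\ge1}$ be the sequential preferential attachment multigraphs with parameters $\alpha$ and $m$: $G_n$ has vertex set $[n]=\{1,\dots,n\}$, $G_1$ has no edges, and for $n\ge2$ the graph $G_n$ is obtained from $G_{n-1}$ by adding the vertex $n$ and attaching $m$ edges from $n$ to vertices of $[n-1]$, one after the other. Given $G_{n-1}$ and the first $i-1$ of these edges, the $i$-th edge is attached to $k\in[n-1]$ with probability $$\alpha_n(i)\,\frac1{n-1}+\bigl(1-\alpha_n(i)\bigr)\frac{\deg_n(k,i)}{2m(n-2)+i-1},\qquad \alpha_n(i)=\alpha\,\frac{2m(n-1)}{2m(n-2)+2m\alpha+(1-\alpha)(i-1)},$$ where $\deg_n(k,i)$ is the degree of $k$ in $G_{n-1}$ together with the first $i-1$ edges of $n$ (all edges of the vertex $2$ go to the vertex $1$). Let $\chi=\frac{1+2u}{2+2u}$ with $u=\frac{\alpha}{1-\alpha}$, and $\chi=1$ if $\alpha=1$. For an integer $l\ge1$ write $v\leftrightarrow_l w$ if the graph contains a path (with distinct vertices) with exactly $l$ edges from $v$ to $w$. Then for every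 integer $l\ge1$ there is a constant $C$, depending only on the model parameters $\alpha, m$ and on $l$, such that for all $n\ge1$ and every vertex $v\in[n]$ of $G_n$, $$\mathbf P\bigl(v\leftrightarrow_l n \text{ in } G_n\bigr)\le C\,\frac{(\log n)^l}{n^{\chi}}.$$ -/

import Mathlib

/-!
The sequential preferential attachment model with parameters `α ∈ [0,1]` and `m`.
A multigraph with vertices labelled by natural numbers is recorded by the multiset of its edges.
-/

namespace SeqPA

/-- The degree of the vertex `k` in the multigraph with edge multiset `E` (no loops ever occur). -/
def deg (E : Multiset (Sym2 ℕ)) (k : ℕ) : ℕ :=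
  E.countP (fun e => k ∈ e)

/-- The sum of the degrees of the vertices in `[N] = {1, …, N}`. -/
def totalDeg (E : Multiset (Sym2 ℕ)) (N : ℕ) : ℕ :=
  ∑ k ∈ Finset.Icc 1 N, deg E k

/-- The uniform attachment coefficient `α_n(i)` used for the `i`-th edge of the new vertex `n`:
`α_n(i) = α · 2m(n-1) / (2m(n-2) + 2mα + (1-α)(i-1))`. -/
noncomputable def unifCoeff (α : Set.Icc (0 : ℝ) 1) (m n i : ℕ) : ℝ :=
  (α : ℝ) * (2 * m * ((n : ℝ) - 1)) /
    (2 * m * ((n : ℝ) - 2) + 2 * m * (α : ℝ) + (1 - (α : ℝ)) * ((i : ℝ) - 1))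

/-- The probability that the `i`-th edge of the new vertex `n` is attached to `k ∈ [n-1]`, when `E`
is the current multigraph (which already contains the first `i - 1` edges of `n`): with
probability `α_n(i)` the endpoint is uniform on `[n-1]`, and with probability `1 - α_n(i)` it is
chosen in proportion to the current degrees of the vertices of `[n-1]`; these degrees add up to
`2m(n-2) + i - 1`.  The only case in which they are all `0` is the first edge of the vertex `2`,
which has to be attached to the vertex `1`. -/
noncomputable def attachProb (α : Set.Icc (0 : ℝ) 1) (m n i : ℕ) (E : Multiset (Sym2 ℕ))
    (k : ℕ) : ℝ :=
  if totalDeg E (n - 1) = 0 then 1 / ((n : ℝ) - 1)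
  else unifCoeff α m n i * (1 / ((n : ℝ) - 1)) +
    (1 - unifCoeff α m n i) * ((deg E k : ℝ) / (totalDeg E (n - 1) : ℝ))

theorem unifCoeff_mem (α : Set.Icc (0 : ℝ) 1) (m n j : ℕ) :
    0 ≤ unifCoeff α m (n + 2) (j + 1) ∧ unifCoeff α m (n + 2) (j + 1) ≤ 1 := by
  obtain ⟨a, h0, h1⟩ := α
  have hm : (0 : ℝ) ≤ m := Nat.cast_nonneg m
  have hn : (0 : ℝ) ≤ n := Nat.cast_nonneg n
  have hj : (0 : ℝ) ≤ j := Nat.cast_nonneg j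
  have ha : (0 : ℝ) ≤ 1 - a := by linarith
  have hmn := mul_nonneg hm hn
  have e : unifCoeff ⟨a, h0, h1⟩ m (n + 2) (j + 1) =
      a * (2 * m * (n + 1)) / (2 * m * n + 2 * m * a + (1 - a) * j) := by
    simp only [unifCoeff]
    push_cast
    ring_nf
  rw [e]
  refine ⟨by positivity, div_le_one_of_le₀ ?_ (by positivity)⟩
  nlinarith [mul_nonneg ha hmn, mul_nonneg ha hj]

theorem attachProb_nonneg (α : Set.Icc (0 : ℝ) 1) (m n j : ℕ) (E : Multiset (Sym2 ℕ)) (k : ℕ) :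
    0 ≤ attachProb α m (n + 2) (j + 1) E k := by
  obtain ⟨h0, h1⟩ := unifCoeff_mem α m n j
  have hn : (0 : ℝ) ≤ ((n + 2 : ℕ) : ℝ) - 1 := by
    push_cast
    linarith [(Nat.cast_nonneg n : (0 : ℝ) ≤ n)]
  have h2 : 0 ≤ 1 - unifCoeff α m (n + 2) (j + 1) := by linarith
  unfold attachProb
  split_ifs <;> positivity

theorem sum_attachProb (α : Set.Icc (0 : ℝ) 1) (m n j : ℕ) (E : Multiset (Sym2 ℕ)) :
    ∑ k ∈ Finset.Icc 1 (n + 1), attachProb α m (n + 2) (j + 1) E k = 1 := by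
  have hn : ((n + 2 : ℕ) : ℝ) - 1 = (n : ℝ) + 1 := by push_cast; ring
  have hn0 : (n : ℝ) + 1 ≠ 0 := by positivity
  have hs : n + 2 - 1 = n + 1 := by omega
  unfold attachProb
  rw [hn, hs]
  split_ifs with h
  · simp [Finset.sum_const, hn0]
  · have hT : (totalDeg E (n + 1) : ℝ) ≠ 0 := by exact_mod_cast h
    have hd : ∑ k ∈ Finset.Icc 1 (n + 1), (deg E k : ℝ) = (totalDeg E (n + 1) : ℝ) := by
      simp [totalDeg]
    have h1 : ∑ _k ∈ Finset.Icc 1 (n + 1), 1 / ((n : ℝ) + 1) = 1 := by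
      simp [Finset.sum_const, hn0]
    have h2 : ∑ k ∈ Finset.Icc 1 (n + 1), (deg E k : ℝ) / (totalDeg E (n + 1) : ℝ) = 1 := by
      rw [← Finset.sum_div, hd, div_self hT]
    rw [Finset.sum_add_distrib, ← Finset.mul_sum, ← Finset.mul_sum, h1, h2]
    ring

/-- The random endpoint in `[n+1]` of the `(j+1)`-st edge of the new vertex `n + 2`. -/
noncomputable def target (α : Set.Icc (0 : ℝ) 1) (m n j : ℕ) (E : Multiset (Sym2 ℕ)) : PMF ℕ :=
  PMF.ofFinset
    (fun k => if k ∈ Finset.Icc 1 (n + 1) then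
      ENNReal.ofReal (attachProb α m (n + 2) (j + 1) E k) else 0)
    (Finset.Icc 1 (n + 1))
    (by
      rw [Finset.sum_congr rfl (fun k hk => if_pos hk),
        ← ENNReal.ofReal_sum_of_nonneg (fun k _ => attachProb_nonneg α m n j E k),
        sum_attachProb, ENNReal.ofReal_one])
    (fun _ hk => if_neg hk)

/-- The multigraph after the first `j` edges of the new vertex `n + 2` have been attached, one by
one, to the multigraph `E`, with attachment probabilities updated after each edge. -/
noncomputable def addEdges (α : Set.Icc (0 : ℝ) 1) (m n : ℕ) (E : Multiset (Sym2 ℕ)) :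
    ℕ → PMF (Multiset (Sym2 ℕ))
  | 0 => PMF.pure E
  | j + 1 => (addEdges α m n E j).bind fun E' =>
      (target α m n j E').map fun k => s(k, n + 2) ::ₘ E'

/-- The law of `G_n`: `G_1` is the vertex `1` without edges, and each further vertex sends `m`
edges, one by one, to the earlier vertices (`n = 0` is a dummy value). -/
noncomputable def graphLaw (α : Set.Icc (0 : ℝ) 1) (m : ℕ) : ℕ → PMF (Multiset (Sym2 ℕ))
  | 0 => PMF.pure 0
  | 1 => PMF.pure 0
  | n + 2 => (graphLaw α m (n + 1)).bind fun E => addEdges α m n E m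

/-- `v ↔_l w`: there is a path (all vertices distinct) with exactly `l` edges from `v` to `w` in the
multigraph with edge multiset `E`.  Multiplicities do not matter for this. -/
def Joined (E : Multiset (Sym2 ℕ)) (l v w : ℕ) : Prop :=
  ∃ p : (SimpleGraph.fromEdgeSet {e : Sym2 ℕ | e ∈ E}).Walk v w, p.IsPath ∧ p.length = l

/-- The exponent `χ = (1 + 2u) / (2 + 2u)` with `u = α / (1 - α)`; when `α = 1`, that is `u = ∞`,
it is the limit value `χ = 1`. -/
noncomputable def chi (α : Set.Icc (0 : ℝ) 1) : ℝ :=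
  if (α : ℝ) = 1 then 1
  else (1 + 2 * ((α : ℝ) / (1 - (α : ℝ)))) / (2 + 2 * ((α : ℝ) / (1 - (α : ℝ))))

end SeqPA

/-! Put c = 1 - α and β = c/2, so that χ = 1 - β. The core is a bound for a fixed finite edge set S
inside [n]: the probability that all of S is present is at most a product over e ∈ S of a constant
times b^(-β) s^(β-1), where b < s are the endpoints of e (`toOuterMeasure_subset_le`). The constant
depends on |S|, α and m only.

The coefficient α_n(i) makes each attachment probability equal to w/Z, with w = c·deg + 2mα and Z at
least 2m times the number of earlier vertices minus one (`attachProb_eq`). An attachment raises w to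
w + c, and w · (w+c)(w+2c)⋯(w+dc) is the rising product of length d+1 from w. Hence the conditional
expectation of a product of rising products of total length D grows by a factor at most 1 + cD/Z per
new edge, and demanding an edge to b costs 1/Z and lengthens the product at b by one. The edges of S
are thus handled jointly, without any independence: at time t, the product at b has one factor for
each edge of S still to be received by b. Over the birth of a vertex each pending edge gains
exp(β/n), which telescopes to about (s/b)^β; the birth of s costs about 1/s, and the birth of b
costs a constant.

A union bound over trails from v to n then leaves sums of products of kernels. Since the kernel of
{v,x} times x^(-β) is at most v^(-β)/x (`kernel_mul_rpow_le`), each intermediate vertex contributes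
a harmonic sum, hence a factor 1 + log n, and the last step leaves v^(-β) n^(β-1) ≤ n^(-χ). -/

namespace SeqPA

/-! ### Expectations of real functions under a `PMF` -/

/-- The expectation of (the nonnegative part of) `g` under `p`. -/
noncomputable def ex {β : Type*} (p : PMF β) (g : β → ℝ) : ENNReal :=
  ∑' x, p x * ENNReal.ofReal (g x)

theorem ex_pure {β : Type*} (a : β) (g : β → ℝ) : ex (PMF.pure a) g = ENNReal.ofReal (g a) := by
  unfold ex
  rw [tsum_eq_single a]
  · simp
  · intro b hb
    simp [PMF.pure_apply, hb]

theorem ex_bind {β γ : Type*} (p : PMF β) (q : β → PMF γ) (g : γ → ℝ) :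
    ex (p.bind q) g = ∑' x, p x * ex (q x) g := by
  unfold ex
  simp only [PMF.bind_apply, ← ENNReal.tsum_mul_right, ← ENNReal.tsum_mul_left]
  rw [ENNReal.tsum_comm]
  simp only [mul_assoc]

/-- The bound is demanded only on the support, because the edge and degree counts used later hold
only for graphs that can occur. -/
theorem ex_bind_le {β γ : Type*} (p : PMF β) (q : β → PMF γ) (g : γ → ℝ) (h : β → ℝ)
    (H : ∀ x ∈ p.support, ex (q x) g ≤ ENNReal.ofReal (h x)) : ex (p.bind q) g ≤ ex p h := by
  rw [ex_bind]
  refine ENNReal.tsum_le_tsum fun x => ?_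
  by_cases hx : x ∈ p.support
  · exact mul_le_mul_right (H x hx) _
  · rw [PMF.mem_support_iff, not_not] at hx
    simp [hx]

theorem ex_mono {β : Type*} (p : PMF β) (g h : β → ℝ) (H : ∀ x ∈ p.support, g x ≤ h x) :
    ex p g ≤ ex p h := by
  refine ENNReal.tsum_le_tsum fun x => ?_
  by_cases hx : x ∈ p.support
  · exact mul_le_mul_right (ENNReal.ofReal_le_ofReal (H x hx)) _
  · rw [PMF.mem_support_iff, not_not] at hx
    simp [hx]

theorem ex_const {β : Type*} (p : PMF β) (c : ℝ) : ex p (fun _ => c) = ENNReal.ofReal c := by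
  unfold ex
  rw [ENNReal.tsum_mul_right, p.tsum_coe, one_mul]

theorem ex_add {β : Type*} (p : PMF β) (g h : β → ℝ) (hg : ∀ x, 0 ≤ g x) (hh : ∀ x, 0 ≤ h x) :
    ex p (fun x => g x + h x) = ex p g + ex p h := by
  unfold ex
  rw [← ENNReal.tsum_add]
  refine tsum_congr fun x => ?_
  rw [ENNReal.ofReal_add (hg x) (hh x), mul_add]

theorem ex_smul {β : Type*} (p : PMF β) (g : β → ℝ) (c : ℝ) (hc : 0 ≤ c) :
    ex p (fun x => c * g x) = ENNReal.ofReal c * ex p g := by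
  unfold ex
  rw [← ENNReal.tsum_mul_left]
  refine tsum_congr fun x => ?_
  rw [ENNReal.ofReal_mul hc]
  ring

theorem ex_sum {β ι : Type*} (p : PMF β) (s : Finset ι) (g : ι → β → ℝ)
    (hg : ∀ i x, 0 ≤ g i x) : ex p (fun x => ∑ i ∈ s, g i x) = ∑ i ∈ s, ex p (g i) := by
  classical
  induction s using Finset.induction_on with
  | empty => simp [ex]
  | insert a s ha ih =>
    simp only [Finset.sum_insert ha]
    rw [ex_add p (g a) (fun x => ∑ i ∈ s, g i x) (hg a)
      (fun x => Finset.sum_nonneg fun i _ => hg i x), ih]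

theorem ex_map {β γ : Type*} (p : PMF β) (f : β → γ) (g : γ → ℝ) :
    ex (p.map f) g = ex p (fun x => g (f x)) := by
  unfold PMF.map
  rw [ex_bind]
  simp only [Function.comp, ex_pure]
  rfl

theorem toOuterMeasure_le_ex {β : Type*} (p : PMF β) (s : Set β) (g : β → ℝ)
    (h : ∀ x ∈ s, x ∈ p.support → 1 ≤ g x) : p.toOuterMeasure s ≤ ex p g := by
  rw [PMF.toOuterMeasure_apply]
  refine ENNReal.tsum_le_tsum fun x => ?_
  by_cases hx : x ∈ s
  · rw [Set.indicator_of_mem hx]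
    by_cases hp : x ∈ p.support
    · calc p x = p x * ENNReal.ofReal 1 := by simp
        _ ≤ _ := mul_le_mul_right (ENNReal.ofReal_le_ofReal (h x hx hp)) _
    · rw [PMF.mem_support_iff, not_not] at hp
      simp [hp]
  · rw [Set.indicator_of_notMem hx]
    exact zero_le

theorem ex_target (α : Set.Icc (0 : ℝ) 1) (m n j : ℕ) (E : Multiset (Sym2 ℕ)) (g : ℕ → ℝ) :
    ex (target α m n j E) g ≤
      ∑ k ∈ Finset.Icc 1 (n + 1), ENNReal.ofReal (attachProb α m (n + 2) (j + 1) E k * g k) := by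
  unfold ex target
  rw [tsum_eq_sum (s := Finset.Icc 1 (n + 1))]
  · refine Finset.sum_le_sum fun k hk => ?_
    rw [PMF.ofFinset_apply, if_pos hk, ENNReal.ofReal_mul (attachProb_nonneg α m n j E k)]
  · intro k hk
    rw [PMF.ofFinset_apply, if_neg hk, zero_mul]

theorem mem_Icc_of_mem_support_target {α : Set.Icc (0 : ℝ) 1} {m n j : ℕ} {E : Multiset (Sym2 ℕ)}
    {k : ℕ} (hk : k ∈ (target α m n j E).support) : k ∈ Finset.Icc 1 (n + 1) := by
  by_contra h
  rw [PMF.mem_support_iff] at hk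
  apply hk
  unfold target
  rw [PMF.ofFinset_apply, if_neg h]

/-! ### Edge and degree counts along the process -/

/-- All edges join two distinct vertices of `[N]`. -/
def EdgesIn (N : ℕ) (E : Multiset (Sym2 ℕ)) : Prop :=
  ∀ e ∈ E, 1 ≤ e.inf ∧ e.inf < e.sup ∧ e.sup ≤ N

theorem EdgesIn.mono {N M : ℕ} {E : Multiset (Sym2 ℕ)} (h : EdgesIn N E) (hNM : N ≤ M) :
    EdgesIn M E := fun e he => ⟨(h e he).1, (h e he).2.1, (h e he).2.2.trans hNM⟩

theorem mem_iff_eq_inf_or_eq_sup (k : ℕ) (e : Sym2 ℕ) : k ∈ e ↔ k = e.inf ∨ k = e.sup := by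
  induction e with
  | _ a b =>
    rw [Sym2.mem_iff, Sym2.inf_mk, Sym2.sup_mk]
    omega

theorem deg_cons (e : Sym2 ℕ) (E : Multiset (Sym2 ℕ)) (k : ℕ) :
    deg (e ::ₘ E) k = deg E k + if k ∈ e then 1 else 0 :=
  Multiset.countP_cons _ _ _

theorem totalDeg_eq_two_mul_card {N : ℕ} {E : Multiset (Sym2 ℕ)} (h : EdgesIn N E) :
    totalDeg E N = 2 * E.card := by
  induction E using Multiset.induction_on with
  | empty => simp [totalDeg, deg]
  | cons e E ih =>
    have h1 := ih fun f hf => h f (Multiset.mem_cons_of_mem hf)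
    obtain ⟨h2, h3, h4⟩ := h e (Multiset.mem_cons_self _ _)
    unfold totalDeg at h1 ⊢
    simp only [deg_cons, Finset.sum_add_distrib, h1, Multiset.card_cons]
    have h5 : ∑ k ∈ Finset.Icc 1 N, (if k ∈ e then 1 else 0) = 2 := by
      rw [← Finset.sum_filter, Finset.sum_const, smul_eq_mul, mul_one]
      have : (Finset.Icc 1 N).filter (fun k => k ∈ e) = {e.inf, e.sup} := by
        ext k
        simp only [Finset.mem_filter, Finset.mem_Icc, mem_iff_eq_inf_or_eq_sup,
          Finset.mem_insert, Finset.mem_singleton]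
        omega
      rw [this, Finset.card_pair h3.ne]
    omega

theorem deg_eq_zero_of_edgesIn {N k : ℕ} {E : Multiset (Sym2 ℕ)} (h : EdgesIn N E) (hk : N < k) :
    deg E k = 0 := by
  unfold deg
  rw [Multiset.countP_eq_zero]
  intro e he hke
  rw [mem_iff_eq_inf_or_eq_sup] at hke
  have := h e he
  omega

/-- The properties of the multigraph after the first `j` edges of the vertex `n + 2`. -/
structure Partial (m n j : ℕ) (E : Multiset (Sym2 ℕ)) : Prop where
  edgesIn : EdgesIn (n + 2) E
  card_eq : E.card = m * n + j
  deg_new : deg E (n + 2) = j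

/-- The degree sum over [n+2] is 2(mn + j); the new vertex accounts for j of it and is not among the
possible targets. -/
theorem Partial.totalDeg_eq {m n j : ℕ} {E : Multiset (Sym2 ℕ)} (h : Partial m n j E) :
    totalDeg E (n + 1) = 2 * m * n + j := by
  have h1 := totalDeg_eq_two_mul_card h.edgesIn
  unfold totalDeg at h1 ⊢
  rw [Finset.sum_Icc_succ_top (by omega : 1 ≤ n + 1 + 1), h.deg_new, h.card_eq] at h1
  have : 2 * (m * n + j) = 2 * m * n + 2 * j := by ring
  omega

theorem partial_zero {m n : ℕ} {E : Multiset (Sym2 ℕ)} (h : EdgesIn (n + 1) E)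
    (hc : E.card = m * n) : Partial m n 0 E :=
  ⟨h.mono (by omega), hc, deg_eq_zero_of_edgesIn h (by omega)⟩

theorem partial_of_mem_support_addEdges {α : Set.Icc (0 : ℝ) 1} {m n : ℕ} {E : Multiset (Sym2 ℕ)}
    (h : Partial m n 0 E) (j : ℕ) :
    ∀ E' ∈ (addEdges α m n E j).support, Partial m n j E' := by
  induction j with
  | zero =>
    intro E' hE'
    rw [addEdges, PMF.support_pure, Set.mem_singleton_iff] at hE'
    rwa [hE']
  | succ j ih =>
    intro E' hE'
    rw [addEdges, PMF.mem_support_bind_iff] at hE'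
    obtain ⟨E₁, h1, h2⟩ := hE'
    rw [PMF.mem_support_map_iff] at h2
    obtain ⟨k, hk, rfl⟩ := h2
    have hk' := Finset.mem_Icc.1 (mem_Icc_of_mem_support_target hk)
    have h3 := ih E₁ h1
    refine ⟨?_, ?_, ?_⟩
    · intro e he
      rcases Multiset.mem_cons.1 he with rfl | he
      · rw [Sym2.inf_mk, Sym2.sup_mk]
        omega
      · exact h3.edgesIn e he
    · rw [Multiset.card_cons, h3.card_eq]
      ring
    · rw [deg_cons, h3.deg_new, if_pos (Sym2.mem_mk_right _ _)]

theorem partial_of_mem_support_graphLaw {α : Set.Icc (0 : ℝ) 1} {m : ℕ} (n : ℕ) :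
    ∀ E ∈ (graphLaw α m (n + 1)).support, Partial m n 0 E := by
  induction n with
  | zero =>
    intro E hE
    rw [graphLaw, PMF.support_pure, Set.mem_singleton_iff] at hE
    subst hE
    exact partial_zero (fun e he => by simp at he) (by simp)
  | succ n ih =>
    intro E hE
    rw [graphLaw, PMF.mem_support_bind_iff] at hE
    obtain ⟨E₁, h1, h2⟩ := hE
    have h3 := partial_of_mem_support_addEdges (ih E₁ h1) m E h2
    exact partial_zero h3.edgesIn (by rw [h3.card_eq]; ring)

theorem edgesIn_of_mem_support_graphLaw {α : Set.Icc (0 : ℝ) 1} {m : ℕ} (n : ℕ) :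
    ∀ E ∈ (graphLaw α m (n + 2)).support, EdgesIn (n + 2) E := by
  intro E hE
  rw [graphLaw, PMF.mem_support_bind_iff] at hE
  obtain ⟨E₁, h1, h2⟩ := hE
  exact (partial_of_mem_support_addEdges (partial_of_mem_support_graphLaw n E₁ h1) m E h2).edgesIn

/-! ### Attachment probabilities as normalized affine weights -/

/-- The affine function of the degree of `k` to which the attachment probability is
proportional. -/
noncomputable def weight (α : Set.Icc (0 : ℝ) 1) (m : ℕ) (E : Multiset (Sym2 ℕ)) (k : ℕ) : ℝ :=
  (1 - (α : ℝ)) * deg E k + 2 * m * (α : ℝ)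

/-- The total weight when the `(j+1)`-st edge of the vertex `n + 2` is attached. -/
noncomputable def totalWeight (α : Set.Icc (0 : ℝ) 1) (m n j : ℕ) : ℝ :=
  2 * m * n + 2 * m * (α : ℝ) + (1 - (α : ℝ)) * j

theorem weight_nonneg (α : Set.Icc (0 : ℝ) 1) (m : ℕ) (E : Multiset (Sym2 ℕ)) (k : ℕ) :
    0 ≤ weight α m E k := by
  have h0 := α.2.1
  have h1 : (0 : ℝ) ≤ 1 - (α : ℝ) := sub_nonneg.2 α.2.2
  unfold weight
  positivity

theorem le_totalWeight (α : Set.Icc (0 : ℝ) 1) (m n j : ℕ) :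
    2 * (m : ℝ) * n ≤ totalWeight α m n j := by
  have h0 := α.2.1
  have h1 : (0 : ℝ) ≤ 1 - (α : ℝ) := sub_nonneg.2 α.2.2
  unfold totalWeight
  have : 0 ≤ 2 * m * (α : ℝ) + (1 - (α : ℝ)) * j := by positivity
  linarith

/-- The uniform part is 2mα/Z, and 1 - α_n(i) equals (1-α) times the current degree sum over Z, so
that the degree sum cancels. The condition n ≥ 1 leaves out the vertex 2, whose first edge meets
only zero degrees. -/
theorem attachProb_eq {α : Set.Icc (0 : ℝ) 1} {m n j : ℕ} {E : Multiset (Sym2 ℕ)}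
    (hm : 1 ≤ m) (hn : 1 ≤ n) (h : Partial m n j E) (k : ℕ) :
    attachProb α m (n + 2) (j + 1) E k = weight α m E k / totalWeight α m n j := by
  have hT := h.totalDeg_eq
  have hmn : 0 < m * n := Nat.mul_pos hm hn
  have hmnR : (0 : ℝ) < (m : ℝ) * n := by exact_mod_cast hmn
  have hZ : 0 < totalWeight α m n j := lt_of_lt_of_le (by linarith) (le_totalWeight α m n j)
  have hT0 : totalDeg E (n + 2 - 1) ≠ 0 := by
    rw [show n + 2 - 1 = n + 1 by omega, hT]
    nlinarith
  unfold attachProb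
  rw [if_neg hT0, show n + 2 - 1 = n + 1 by omega, hT]
  have hu : unifCoeff α m (n + 2) (j + 1) =
      (α : ℝ) * (2 * m * ((n : ℝ) + 1)) / totalWeight α m n j := by
    unfold unifCoeff totalWeight
    push_cast
    ring_nf
  rw [hu]
  have hTR : (0 : ℝ) < ((2 * m * n + j : ℕ) : ℝ) := by
    push_cast
    have : (0 : ℝ) ≤ j := Nat.cast_nonneg j
    linarith
  have hn1 : (0 : ℝ) < (n : ℝ) + 1 := by positivity
  have hn2 : ((n + 2 : ℕ) : ℝ) - 1 = n + 1 := by push_cast; ring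
  rw [hn2]
  have e1 : 1 - (α : ℝ) * (2 * m * ((n : ℝ) + 1)) / totalWeight α m n j =
      (1 - (α : ℝ)) * ((2 * m * n + j : ℕ) : ℝ) / totalWeight α m n j := by
    rw [eq_div_iff hZ.ne', sub_mul, div_mul_cancel₀ _ hZ.ne']
    unfold totalWeight
    push_cast
    ring
  rw [e1]
  unfold weight
  field_simp
  ring

theorem sum_weight {α : Set.Icc (0 : ℝ) 1} {m n j : ℕ} {E : Multiset (Sym2 ℕ)}
    (h : Partial m n j E) :
    ∑ k ∈ Finset.Icc 1 (n + 1), weight α m E k = totalWeight α m n j := by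
  have hT := h.totalDeg_eq
  have : ((∑ k ∈ Finset.Icc 1 (n + 1), deg E k : ℕ) : ℝ) = 2 * m * n + j := by
    rw [show ∑ k ∈ Finset.Icc 1 (n + 1), deg E k = 2 * m * n + j from hT]
    push_cast
    ring
  unfold weight totalWeight
  rw [Finset.sum_add_distrib, ← Finset.mul_sum, ← Nat.cast_sum, this, Finset.sum_const]
  simp only [Nat.card_Icc, nsmul_eq_mul]
  push_cast
  ring

/-! ### Rising products and the potential -/

/-- The rising product `w (w + c) ⋯ (w + (d - 1) c)`. -/
noncomputable def rising (c w : ℝ) (d : ℕ) : ℝ :=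
  ∏ i ∈ Finset.range d, (w + c * i)

theorem rising_succ (c w : ℝ) (d : ℕ) : rising c w (d + 1) = rising c w d * (w + c * d) :=
  Finset.prod_range_succ _ _

theorem rising_succ' (c w : ℝ) (d : ℕ) : rising c w (d + 1) = w * rising c (w + c) d := by
  unfold rising
  rw [Finset.prod_range_succ', mul_comm]
  congr 1
  · simp
  · refine Finset.prod_congr rfl fun i _ => ?_
    push_cast
    ring

theorem rising_nonneg {c w : ℝ} (hc : 0 ≤ c) (hw : 0 ≤ w) (d : ℕ) : 0 ≤ rising c w d :=
  Finset.prod_nonneg fun i _ => by positivity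

theorem rising_le {c w : ℝ} (hc : 0 ≤ c) (hw : 0 ≤ w) {d D : ℕ} (hd : d ≤ D) :
    rising c w d ≤ (w + c * D) ^ d := by
  unfold rising
  calc ∏ i ∈ Finset.range d, (w + c * i) ≤ ∏ _i ∈ Finset.range d, (w + c * D) := by
        refine Finset.prod_le_prod (fun i _ => by positivity) fun i hi => ?_
        have : (i : ℝ) ≤ D := by
          exact_mod_cast (Finset.mem_range.1 hi).le.trans hd
        gcongr
    _ = _ := by simp

/-- The product over the vertices of `[N]` of rising products of their weights. -/
noncomputable def potential (α : Set.Icc (0 : ℝ) 1) (m N : ℕ) (E : Multiset (Sym2 ℕ))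
    (d : ℕ → ℕ) : ℝ :=
  ∏ b ∈ Finset.Icc 1 N, rising (1 - (α : ℝ)) (weight α m E b) (d b)

theorem potential_nonneg (α : Set.Icc (0 : ℝ) 1) (m N : ℕ) (E : Multiset (Sym2 ℕ)) (d : ℕ → ℕ) :
    0 ≤ potential α m N E d :=
  Finset.prod_nonneg fun b _ => rising_nonneg (sub_nonneg.2 α.2.2) (weight_nonneg α m E b) _

/-- Attaching to k shifts its weight by 1 - α, and a factor w in front of the shifted rising product
is exactly the missing first factor. This is why rising products replace powers. -/
theorem weight_mul_potential_cons (α : Set.Icc (0 : ℝ) 1) (m n : ℕ) (E : Multiset (Sym2 ℕ))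
    (d : ℕ → ℕ) {k : ℕ} (hk : k ∈ Finset.Icc 1 (n + 1)) :
    weight α m E k * potential α m (n + 1) (s(k, n + 2) ::ₘ E) d =
      potential α m (n + 1) E (d + Pi.single k 1) := by
  unfold potential
  rw [← Finset.mul_prod_erase _ _ hk, ← Finset.mul_prod_erase _ _ hk, ← mul_assoc]
  congr 1
  · have hw : weight α m (s(k, n + 2) ::ₘ E) k = weight α m E k + (1 - (α : ℝ)) := by
      unfold weight
      rw [deg_cons, if_pos (Sym2.mem_mk_left _ _)]
      push_cast
      ring
    rw [hw, Pi.add_apply, Pi.single_eq_same, rising_succ']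
  · refine Finset.prod_congr rfl fun b hb => ?_
    rw [Finset.mem_erase, Finset.mem_Icc] at hb
    have hw : weight α m (s(k, n + 2) ::ₘ E) b = weight α m E b := by
      unfold weight
      rw [deg_cons, if_neg (by rw [Sym2.mem_iff]; omega), add_zero]
    rw [hw, Pi.add_apply, Pi.single_eq_of_ne hb.1, add_zero]

theorem potential_add_single (α : Set.Icc (0 : ℝ) 1) (m n : ℕ) (E : Multiset (Sym2 ℕ))
    (d : ℕ → ℕ) {k : ℕ} (hk : k ∈ Finset.Icc 1 (n + 1)) :
    potential α m (n + 1) E (d + Pi.single k 1) =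
      potential α m (n + 1) E d * (weight α m E k + (1 - (α : ℝ)) * d k) := by
  unfold potential
  rw [← Finset.mul_prod_erase _ _ hk, ← Finset.mul_prod_erase _ (fun b => rising _ _ (d b)) hk,
    Pi.add_apply, Pi.single_eq_same, rising_succ]
  have : ∏ b ∈ (Finset.Icc 1 (n + 1)).erase k,
      rising (1 - (α : ℝ)) (weight α m E b) ((d + Pi.single k 1 : ℕ → ℕ) b) =
      ∏ b ∈ (Finset.Icc 1 (n + 1)).erase k, rising (1 - (α : ℝ)) (weight α m E b) (d b) := by
    refine Finset.prod_congr rfl fun b hb => ?_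
    rw [Pi.add_apply, Pi.single_eq_of_ne (Finset.ne_of_mem_erase hb), add_zero]
  rw [this]
  ring

/-! ### The birth of one vertex with prescribed neighbours -/

open Classical in
/-- The potential on the event that the vertex `n + 2` is joined to all vertices of `R`. -/
noncomputable def hitPotential (α : Set.Icc (0 : ℝ) 1) (m n : ℕ) (R : Finset ℕ) (d : ℕ → ℕ)
    (E : Multiset (Sym2 ℕ)) : ℝ :=
  if ∀ b ∈ R, s(b, n + 2) ∈ E then potential α m (n + 1) E d else 0

theorem hitPotential_nonneg (α : Set.Icc (0 : ℝ) 1) (m n : ℕ) (R : Finset ℕ) (d : ℕ → ℕ)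
    (E : Multiset (Sym2 ℕ)) : 0 ≤ hitPotential α m n R d E := by
  unfold hitPotential
  split_ifs
  · exact potential_nonneg _ _ _ _ _
  · exact le_rfl

/-- If the event holds after attaching to k ∉ R, it held before. If k ∈ R, only the other vertices
of R must have been hit before, and the new edge turns into one more factor at k. -/
theorem weight_mul_hitPotential_cons_le (α : Set.Icc (0 : ℝ) 1) (m n : ℕ) (R : Finset ℕ)
    (d : ℕ → ℕ) (E : Multiset (Sym2 ℕ)) {k : ℕ} (hk : k ∈ Finset.Icc 1 (n + 1)) :
    weight α m E k * hitPotential α m n R d (s(k, n + 2) ::ₘ E) ≤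
      hitPotential α m n R d E * (weight α m E k + (1 - (α : ℝ)) * d k) +
        if k ∈ R then hitPotential α m n (R.erase k) (d + Pi.single k 1) E else 0 := by
  have hc : (0 : ℝ) ≤ 1 - (α : ℝ) := sub_nonneg.2 α.2.2
  have hw := weight_nonneg α m E k
  have hA : 0 ≤ hitPotential α m n R d E * (weight α m E k + (1 - (α : ℝ)) * d k) :=
    mul_nonneg (hitPotential_nonneg _ _ _ _ _ _) (by positivity)
  have hB : 0 ≤ if k ∈ R then hitPotential α m n (R.erase k) (d + Pi.single k 1) E else 0 := by
    split_ifs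
    · exact hitPotential_nonneg _ _ _ _ _ _
    · exact le_rfl
  by_cases h : ∀ b ∈ R, s(b, n + 2) ∈ s(k, n + 2) ::ₘ E
  · have e1 : weight α m E k * hitPotential α m n R d (s(k, n + 2) ::ₘ E) =
        potential α m (n + 1) E (d + Pi.single k 1) := by
      unfold hitPotential
      rw [if_pos h, weight_mul_potential_cons α m n E d hk]
    have h' : ∀ b ∈ R, b ≠ k → s(b, n + 2) ∈ E := by
      intro b hb hbk
      rcases Multiset.mem_cons.1 (h b hb) with h1 | h1
      · exact absurd (Sym2.congr_left.1 h1) hbk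
      · exact h1
    rw [e1]
    by_cases hkR : k ∈ R
    · rw [if_pos hkR]
      have e2 : hitPotential α m n (R.erase k) (d + Pi.single k 1) E =
          potential α m (n + 1) E (d + Pi.single k 1) := by
        unfold hitPotential
        rw [if_pos fun b hb => h' b (Finset.mem_of_mem_erase hb) (Finset.ne_of_mem_erase hb)]
      rw [e2]
      linarith
    · have e2 : hitPotential α m n R d E = potential α m (n + 1) E d := by
        unfold hitPotential
        rw [if_pos fun b hb => h' b hb fun hbk => hkR (hbk ▸ hb)]
      rw [e2, potential_add_single α m n E d hk]
      linarith
  · have e1 : hitPotential α m n R d (s(k, n + 2) ::ₘ E) = 0 := by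
      unfold hitPotential
      rw [if_neg h]
    rw [e1, mul_zero]
    linarith

theorem ex_target_hitPotential_le {α : Set.Icc (0 : ℝ) 1} {m n j : ℕ} {E : Multiset (Sym2 ℕ)}
    (hm : 1 ≤ m) (hn : 1 ≤ n) (h : Partial m n j E) (R : Finset ℕ)
    (hR : R ⊆ Finset.Icc 1 (n + 1)) (d : ℕ → ℕ) :
    ex (target α m n j E) (fun k => hitPotential α m n R d (s(k, n + 2) ::ₘ E)) ≤
      ENNReal.ofReal ((1 + (1 - (α : ℝ)) * (∑ b ∈ Finset.Icc 1 (n + 1), d b : ℕ) / (2 * m * n)) *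
        hitPotential α m n R d E +
        ∑ b ∈ R, 1 / (2 * m * n) * hitPotential α m n (R.erase b) (d + Pi.single b 1) E) := by
  have hc : (0 : ℝ) ≤ 1 - (α : ℝ) := sub_nonneg.2 α.2.2
  have hmR : (0 : ℝ) < m := by exact_mod_cast hm
  have hnR : (0 : ℝ) < n := by exact_mod_cast hn
  have hZm : (0 : ℝ) < 2 * m * n := by positivity
  have hZ := le_totalWeight α m n j
  have hZ0 : 0 < totalWeight α m n j := hZm.trans_le hZ
  refine (ex_target α m n j E _).trans ?_
  rw [← ENNReal.ofReal_sum_of_nonneg fun k _ =>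
    mul_nonneg (attachProb_nonneg α m n j E k) (hitPotential_nonneg _ _ _ _ _ _)]
  refine ENNReal.ofReal_le_ofReal ?_
  have e1 : ∑ k ∈ Finset.Icc 1 (n + 1), attachProb α m (n + 2) (j + 1) E k *
      hitPotential α m n R d (s(k, n + 2) ::ₘ E) =
      (∑ k ∈ Finset.Icc 1 (n + 1),
        weight α m E k * hitPotential α m n R d (s(k, n + 2) ::ₘ E)) / totalWeight α m n j := by
    rw [Finset.sum_div]
    refine Finset.sum_congr rfl fun k _ => ?_
    rw [attachProb_eq hm hn h]
    ring
  rw [e1]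
  have e2 : ∑ k ∈ Finset.Icc 1 (n + 1),
      weight α m E k * hitPotential α m n R d (s(k, n + 2) ::ₘ E) ≤
      hitPotential α m n R d E *
        (totalWeight α m n j + (1 - (α : ℝ)) * (∑ b ∈ Finset.Icc 1 (n + 1), d b : ℕ)) +
        ∑ b ∈ R, hitPotential α m n (R.erase b) (d + Pi.single b 1) E := by
    refine (Finset.sum_le_sum fun k hk =>
      weight_mul_hitPotential_cons_le α m n R d E hk).trans (le_of_eq ?_)
    rw [Finset.sum_add_distrib, ← Finset.mul_sum, Finset.sum_add_distrib, sum_weight h,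
      ← Finset.mul_sum, Nat.cast_sum, ← Finset.sum_filter,
      Finset.filter_mem_eq_inter, Finset.inter_eq_right.2 hR]
  refine (div_le_div_of_nonneg_right e2 hZ0.le).trans ?_
  rw [add_div, ← Finset.mul_sum]
  refine add_le_add ?_ ?_
  · rw [mul_div_assoc, mul_comm]
    refine mul_le_mul_of_nonneg_right ?_ (hitPotential_nonneg _ _ _ _ _ _)
    rw [add_div, div_self hZ0.ne']
    gcongr
  · rw [div_eq_mul_one_div, mul_comm]
    refine mul_le_mul_of_nonneg_right (one_div_le_one_div_of_le hZm hZ)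
      (Finset.sum_nonneg fun b _ => hitPotential_nonneg _ _ _ _ _ _)

theorem sum_add_single {N b : ℕ} (d : ℕ → ℕ) (hb : b ∈ Finset.Icc 1 N) :
    ∑ k ∈ Finset.Icc 1 N, (d + Pi.single b 1 : ℕ → ℕ) k = ∑ k ∈ Finset.Icc 1 N, d k + 1 := by
  simp only [Pi.add_apply, Finset.sum_add_distrib, Pi.single_apply, Finset.sum_ite_eq', if_pos hb]

/-- The first two terms of the binomial expansion. They count where r required hits fall among j + 1
edges: all among the first j, or one of them at the last. -/
theorem pow_add_mul_pow_pred_le (j r : ℕ) :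
    (j : ℝ) ^ r + r * (j : ℝ) ^ (r - 1) ≤ ((j : ℝ) + 1) ^ r := by
  have hj : (0 : ℝ) ≤ j := Nat.cast_nonneg j
  induction r with
  | zero => simp
  | succ r ih =>
    rw [pow_succ ((j : ℝ) + 1), Nat.add_sub_cancel]
    have h1 : (j : ℝ) * (r * (j : ℝ) ^ (r - 1)) = r * (j : ℝ) ^ r := by
      rcases r with _ | r
      · simp
      · rw [Nat.add_sub_cancel]
        ring
    have h2 : (0 : ℝ) ≤ r * (j : ℝ) ^ (r - 1) := by positivity
    have h3 := mul_le_mul_of_nonneg_right ih (by positivity : (0 : ℝ) ≤ (j : ℝ) + 1)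
    push_cast
    rw [pow_succ]
    nlinarith

/-- Induction on the number of edges, conditioning on the last one. Moving b from R into d preserves
both `d + 1_R` and the total length of the rising products plus |R|, so every term of the recursion
carries the same potential and the same growth factor. -/
theorem ex_addEdges_hitPotential_le {α : Set.Icc (0 : ℝ) 1} {m n : ℕ} {E : Multiset (Sym2 ℕ)}
    (hm : 1 ≤ m) (hn : 1 ≤ n) (h : Partial m n 0 E) (j : ℕ) :
    ∀ (R : Finset ℕ), R ⊆ Finset.Icc 1 (n + 1) → ∀ d : ℕ → ℕ,
      ex (addEdges α m n E j) (hitPotential α m n R d) ≤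
        ENNReal.ofReal (((j : ℝ) / (2 * m * n)) ^ R.card *
          (1 + (1 - (α : ℝ)) * (∑ b ∈ Finset.Icc 1 (n + 1), d b + R.card : ℕ) / (2 * m * n)) ^ j *
          potential α m (n + 1) E (fun b => d b + if b ∈ R then 1 else 0)) := by
  have hc : (0 : ℝ) ≤ 1 - (α : ℝ) := sub_nonneg.2 α.2.2
  have hmR : (0 : ℝ) < m := by exact_mod_cast hm
  have hnR : (0 : ℝ) < n := by exact_mod_cast hn
  have hZm : (0 : ℝ) < 2 * m * n := by positivity
  induction j with
  | zero =>
    intro R hR d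
    rw [addEdges, ex_pure]
    refine ENNReal.ofReal_le_ofReal ?_
    -- For empty R the prefactor is 0 ^ 0 = 1; otherwise the event fails, since the new vertex has
    -- no edge yet.
    rcases R.eq_empty_or_nonempty with rfl | ⟨b, hb⟩
    · simp [hitPotential]
    · have h0 : hitPotential α m n R d E = 0 := by
        unfold hitPotential
        rw [if_neg]
        intro h1
        have h2 := h.deg_new
        unfold deg at h2
        rw [Multiset.countP_eq_zero] at h2
        exact h2 _ (h1 b hb) (Sym2.mem_mk_right _ _)
      rw [h0]
      exact mul_nonneg (by positivity) (potential_nonneg _ _ _ _ _)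
  | succ j ih =>
    intro R hR d
    set D := ∑ b ∈ Finset.Icc 1 (n + 1), d b with hD
    set x : ℝ := (1 - (α : ℝ)) * (D + R.card : ℕ) / (2 * m * n) with hx
    have hx0 : 0 ≤ x := by positivity
    set P := potential α m (n + 1) E (fun b => d b + if b ∈ R then 1 else 0) with hP
    have hP0 : 0 ≤ P := potential_nonneg _ _ _ _ _
    rw [addEdges]
    refine (ex_bind_le _ _ _ (fun E' => (1 + (1 - (α : ℝ)) * (D : ℕ) / (2 * m * n)) *
        hitPotential α m n R d E' +
        ∑ b ∈ R, 1 / (2 * m * n) * hitPotential α m n (R.erase b) (d + Pi.single b 1) E')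
        fun E' hE' => ?_).trans ?_
    · rw [ex_map]
      exact ex_target_hitPotential_le hm hn (partial_of_mem_support_addEdges h j E' hE') R hR d
    rw [ex_add _ _ _ (fun E' => mul_nonneg (by positivity) (hitPotential_nonneg _ _ _ _ _ _))
      (fun E' => Finset.sum_nonneg fun b _ => mul_nonneg (by positivity)
        (hitPotential_nonneg _ _ _ _ _ _)), ex_smul _ _ _ (by positivity),
      ex_sum _ _ _ (fun b E' => mul_nonneg (by positivity) (hitPotential_nonneg _ _ _ _ _ _))]
    have h1 : ∀ b ∈ R, ex (addEdges α m n E j) (fun E' => 1 / (2 * (m : ℝ) * n) *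
        hitPotential α m n (R.erase b) (d + Pi.single b 1) E') ≤
        ENNReal.ofReal (1 / (2 * (m : ℝ) * n) *
          (((j : ℝ) / (2 * m * n)) ^ (R.card - 1) * (1 + x) ^ j * P)) := by
      intro b hb
      rw [ex_smul _ _ _ (by positivity), ENNReal.ofReal_mul (by positivity)]
      refine mul_le_mul_right ((ih (R.erase b) ((Finset.erase_subset _ _).trans hR)
        (d + Pi.single b 1)).trans (le_of_eq ?_)) _
      have e1 : ∑ k ∈ Finset.Icc 1 (n + 1), (d + Pi.single b 1 : ℕ → ℕ) k + (R.card - 1) =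
          D + R.card := by
        rw [sum_add_single d (hR hb)]
        have := Finset.card_pos.2 ⟨b, hb⟩
        omega
      have e2 : (fun k => (d + Pi.single b 1 : ℕ → ℕ) k + if k ∈ R.erase b then 1 else 0) =
          fun k => d k + if k ∈ R then 1 else 0 := by
        funext k
        by_cases hkb : k = b
        · subst hkb
          simp [hb]
        · simp [hkb]
      rw [Finset.card_erase_of_mem hb, e1, e2]
    refine (add_le_add (mul_le_mul_right (ih R hR d) _) (Finset.sum_le_sum h1)).trans ?_
    rw [Finset.sum_const, nsmul_eq_mul, ← ENNReal.ofReal_mul (by positivity),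
      ← ENNReal.ofReal_natCast, ← ENNReal.ofReal_mul (by positivity),
      ← ENNReal.ofReal_add (by positivity) (by positivity)]
    refine ENNReal.ofReal_le_ofReal ?_
    rw [← hD, ← hx, ← hP]
    have hxd : (1 - (α : ℝ)) * (D : ℕ) / (2 * m * n) ≤ x := by
      rw [hx]
      gcongr
      omega
    have key := pow_add_mul_pow_pred_le j R.card
    have hr : (R.card : ℝ) * (1 / (2 * m * n) * ((j : ℝ) / (2 * m * n)) ^ (R.card - 1)) =
        R.card * (j : ℝ) ^ (R.card - 1) / (2 * m * n) ^ R.card := by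
      rcases Nat.eq_zero_or_pos R.card with h0 | h0
      · simp [h0]
      · obtain ⟨r, hr⟩ : ∃ r, R.card = r + 1 := ⟨R.card - 1, by omega⟩
        rw [hr, Nat.add_sub_cancel, div_pow, pow_succ (2 * (m : ℝ) * n)]
        field_simp
    calc (1 + (1 - (α : ℝ)) * (D : ℕ) / (2 * m * n)) *
          (((j : ℝ) / (2 * m * n)) ^ R.card * (1 + x) ^ j * P) +
          R.card * (1 / (2 * (m : ℝ) * n) *
            (((j : ℝ) / (2 * m * n)) ^ (R.card - 1) * (1 + x) ^ j * P))
        -- The hit term carries no growth factor of its own; the spare 1 + x is inserted to give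
        -- both terms the power j + 1.
        ≤ (1 + x) * (((j : ℝ) / (2 * m * n)) ^ R.card * (1 + x) ^ j * P) +
          (1 + x) * (R.card * (1 / (2 * (m : ℝ) * n) *
            (((j : ℝ) / (2 * m * n)) ^ (R.card - 1) * (1 + x) ^ j * P))) := by
          refine add_le_add (mul_le_mul_of_nonneg_right (by linarith) (by positivity)) ?_
          exact le_mul_of_one_le_left (by positivity) (by linarith)
      _ = (((j : ℝ) / (2 * m * n)) ^ R.card +
          R.card * (1 / (2 * m * n) * ((j : ℝ) / (2 * m * n)) ^ (R.card - 1))) *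
          (1 + x) ^ (j + 1) * P := by ring
      _ = ((j : ℝ) ^ R.card + R.card * (j : ℝ) ^ (R.card - 1)) / (2 * m * n) ^ R.card *
          (1 + x) ^ (j + 1) * P := by rw [hr, div_pow, add_div]
      _ ≤ ((j : ℝ) + 1) ^ R.card / (2 * m * n) ^ R.card * (1 + x) ^ (j + 1) * P := by
          gcongr
      _ = _ := by
          rw [div_pow]
          push_cast
          rfl

theorem mem_of_mem_support_addEdges {α : Set.Icc (0 : ℝ) 1} {m n : ℕ} {E : Multiset (Sym2 ℕ)}
    (j : ℕ) : ∀ E' ∈ (addEdges α m n E j).support, ∀ e ∈ E', e.sup ≤ n + 1 → e ∈ E := by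
  induction j with
  | zero =>
    intro E' hE'
    rw [addEdges, PMF.support_pure, Set.mem_singleton_iff] at hE'
    rw [hE']
    exact fun e he _ => he
  | succ j ih =>
    intro E' hE' e he hs
    rw [addEdges, PMF.mem_support_bind_iff] at hE'
    obtain ⟨E₁, h1, h2⟩ := hE'
    rw [PMF.mem_support_map_iff] at h2
    obtain ⟨k, -, rfl⟩ := h2
    rcases Multiset.mem_cons.1 he with rfl | he
    · rw [Sym2.sup_mk] at hs
      omega
    · exact ih E₁ h1 e he hs

/-! ### Bookkeeping for a prescribed edge set -/

/-- The number of edges of `S` from vertices born after time `t` to the older vertex `b`. -/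
def later (S : Finset (Sym2 ℕ)) (t b : ℕ) : ℕ :=
  (S.filter fun e => e.inf = b ∧ t < e.sup).card

/-- The endpoints in `[t-1]` of the edges of `S` at the vertex `t`. -/
def targets (S : Finset (Sym2 ℕ)) (t : ℕ) : Finset ℕ :=
  (S.filter fun e => e.sup = t).image Sym2.inf

theorem card_targets (S : Finset (Sym2 ℕ)) (t : ℕ) :
    (targets S t).card = (S.filter fun e => e.sup = t).card := by
  refine Finset.card_image_of_injOn fun e he f hf hef => ?_
  rw [Finset.mem_coe, Finset.mem_filter] at he hf
  exact Sym2.inf_eq_inf_and_sup_eq_sup.1 ⟨hef, he.2.trans hf.2.symm⟩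

theorem later_le_card (S : Finset (Sym2 ℕ)) (t b : ℕ) : later S t b ≤ S.card :=
  Finset.card_filter_le _ _

theorem later_eq (S : Finset (Sym2 ℕ)) (t b : ℕ) :
    later S t b = later S (t + 1) b + if b ∈ targets S (t + 1) then 1 else 0 := by
  have h1 : S.filter (fun e => e.inf = b ∧ t < e.sup) =
      S.filter (fun e => e.inf = b ∧ t + 1 < e.sup) ∪
        S.filter (fun e => e.inf = b ∧ e.sup = t + 1) := by
    ext e
    simp only [Finset.mem_union, Finset.mem_filter, ← and_or_left]
    refine and_congr_right fun _ => and_congr_right fun _ => ?_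
    omega
  have h2 : Disjoint (S.filter fun e => e.inf = b ∧ t + 1 < e.sup)
      (S.filter fun e => e.inf = b ∧ e.sup = t + 1) := by
    rw [Finset.disjoint_filter]
    intro e _ h3 h4
    omega
  unfold later
  rw [h1, Finset.card_union_of_disjoint h2]
  congr 1
  split_ifs with hb
  · unfold targets at hb
    rw [Finset.mem_image] at hb
    obtain ⟨e, he, heb⟩ := hb
    rw [Finset.mem_filter] at he
    rw [Finset.card_eq_one]
    refine ⟨e, Finset.ext fun f => ?_⟩
    rw [Finset.mem_filter, Finset.mem_singleton]
    constructor
    · rintro ⟨-, h3, h4⟩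
      exact Sym2.inf_eq_inf_and_sup_eq_sup.1 ⟨h3.trans heb.symm, h4.trans he.2.symm⟩
    · rintro rfl
      exact ⟨he.1, heb, he.2⟩
  · rw [Finset.card_eq_zero, Finset.filter_eq_empty_iff]
    rintro e he ⟨h3, h4⟩
    exact hb (Finset.mem_image.2 ⟨e, Finset.mem_filter.2 ⟨he, h4⟩, h3⟩)

theorem sum_later {S : Finset (Sym2 ℕ)} (hS : ∀ e ∈ S, 1 ≤ e.inf) (t : ℕ) :
    ∑ b ∈ Finset.Icc 1 t, later S t b = (S.filter fun e => e.inf ≤ t ∧ t < e.sup).card := by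
  have h := Finset.card_eq_sum_card_fiberwise (f := Sym2.inf) (t := Finset.Icc 1 t)
    (s := S.filter fun e => e.inf ≤ t ∧ t < e.sup) (by
      intro e he
      rw [Finset.mem_coe, Finset.mem_filter] at he
      exact Finset.mem_coe.2 (Finset.mem_Icc.2 ⟨hS e he.1, he.2.1⟩))
  rw [h]
  refine Finset.sum_congr rfl fun b hb => ?_
  unfold later
  rw [Finset.filter_filter]
  congr 1
  ext e
  simp only [Finset.mem_filter]
  refine and_congr_right fun _ => ?_
  have := (Finset.mem_Icc.1 hb).2
  omega

theorem prod_ite_one {ι : Type*} (S : Finset ι) (p : ι → Prop) [DecidablePred p] (a : ℝ) :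
    ∏ e ∈ S, (if p e then a else 1) = a ^ (S.filter p).card := by
  rw [← Finset.prod_filter, Finset.prod_const]

open Classical in
/-- The potential at time `t` on the event that all edges of `S` at vertices of `[t]` exist. -/
noncomputable def stage (α : Set.Icc (0 : ℝ) 1) (m : ℕ) (S : Finset (Sym2 ℕ)) (t : ℕ)
    (E : Multiset (Sym2 ℕ)) : ℝ :=
  if ∀ e ∈ S, e.sup ≤ t → e ∈ E then potential α m t E (later S t) else 0

/-- The contribution of the edge `e` to the growth of the expected potential when the vertex
`n + 2` is added. -/
noncomputable def stepFactor (α : Set.Icc (0 : ℝ) 1) (A : ℝ) (n : ℕ) (e : Sym2 ℕ) : ℝ :=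
  (if e.sup = n + 2 then 1 / (n : ℝ) else 1) *
    (if e.inf ≤ n + 1 ∧ n + 1 < e.sup then Real.exp ((1 - (α : ℝ)) / 2 / n) else 1) *
    (if e.inf = n + 2 then A else 1)

/-- The weight of a vertex right after its own `m` edges have been attached. -/
noncomputable def newWeight (α : Set.Icc (0 : ℝ) 1) (m : ℕ) : ℝ :=
  (1 - (α : ℝ)) * m + 2 * m * (α : ℝ)

theorem newWeight_nonneg (α : Set.Icc (0 : ℝ) 1) (m : ℕ) : 0 ≤ newWeight α m := by
  have h0 := α.2.1
  have h1 : (0 : ℝ) ≤ 1 - (α : ℝ) := sub_nonneg.2 α.2.2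
  unfold newWeight
  positivity

theorem rising_newWeight_le {α : Set.Icc (0 : ℝ) 1} {m D d : ℕ} {A : ℝ}
    (hA : newWeight α m + (1 - (α : ℝ)) * D ≤ A) (hd : d ≤ D) :
    rising (1 - (α : ℝ)) (newWeight α m) d ≤ A ^ d := by
  have h1 : (0 : ℝ) ≤ 1 - (α : ℝ) := sub_nonneg.2 α.2.2
  have h2 := newWeight_nonneg α m
  exact (rising_le h1 h2 hd).trans (pow_le_pow_left₀ (by positivity) hA d)

/-- The vertex n + 2 must hit its targets in S, which `ex_addEdges_hitPotential_le` controls. Its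
own degree is then exactly m, so its rising product is deterministic and at most a power of A. -/
theorem ex_addEdges_stage_le {α : Set.Icc (0 : ℝ) 1} {m n : ℕ} {E : Multiset (Sym2 ℕ)}
    (hm : 1 ≤ m) (hn : 1 ≤ n) (h : Partial m n 0 E) {S : Finset (Sym2 ℕ)}
    (hS : ∀ e ∈ S, 1 ≤ e.inf ∧ e.inf < e.sup) {A : ℝ} (hA1 : 1 ≤ A)
    (hA : newWeight α m + (1 - (α : ℝ)) * S.card ≤ A) :
    ex (addEdges α m n E m) (stage α m S (n + 2)) ≤
      ENNReal.ofReal ((∏ e ∈ S, stepFactor α A n e) * stage α m S (n + 1) E) := by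
  have hc : (0 : ℝ) ≤ 1 - (α : ℝ) := sub_nonneg.2 α.2.2
  have hmR : (0 : ℝ) < m := by exact_mod_cast hm
  have hnR : (0 : ℝ) < n := by exact_mod_cast hn
  by_cases hold : ∀ e ∈ S, e.sup ≤ n + 1 → e ∈ E
  · have hst : stage α m S (n + 1) E = potential α m (n + 1) E (later S (n + 1)) := by
      unfold stage
      rw [if_pos hold]
    have hR : targets S (n + 2) ⊆ Finset.Icc 1 (n + 1) := by
      intro b hb
      unfold targets at hb
      rw [Finset.mem_image] at hb
      obtain ⟨e, he, rfl⟩ := hb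
      rw [Finset.mem_filter] at he
      have := hS e he.1
      rw [Finset.mem_Icc]
      omega
    have hnew : later S (n + 2) (n + 2) = (S.filter fun e => e.inf = n + 2).card := by
      unfold later
      congr 1
      refine Finset.filter_congr fun e he => ?_
      have := hS e he
      omega
    -- The total length of the rising products just before the birth of n + 2 is the number of
    -- pending edges of S, so the growth factor splits over these edges.
    have hsum : ∑ b ∈ Finset.Icc 1 (n + 1), later S (n + 2) b + (targets S (n + 2)).card =
        (S.filter fun e => e.inf ≤ n + 1 ∧ n + 1 < e.sup).card := by
      rw [← sum_later (fun e he => (hS e he).1), Finset.sum_congr rfl fun b _ =>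
        later_eq S (n + 1) b, Finset.sum_add_distrib, ← Finset.sum_filter,
        Finset.filter_mem_eq_inter, Finset.inter_eq_right.2 hR]
      simp
    refine (ex_mono _ _ (fun E' => A ^ later S (n + 2) (n + 2) *
      hitPotential α m n (targets S (n + 2)) (later S (n + 2)) E') fun E' hE' => ?_).trans ?_
    · have hE'' := partial_of_mem_support_addEdges h m E' hE'
      by_cases hall : ∀ e ∈ S, e.sup ≤ n + 2 → e ∈ E'
      · have hhit : hitPotential α m n (targets S (n + 2)) (later S (n + 2)) E' =
            potential α m (n + 1) E' (later S (n + 2)) := by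
          unfold hitPotential
          rw [if_pos]
          intro b hb
          unfold targets at hb
          rw [Finset.mem_image] at hb
          obtain ⟨e, he, rfl⟩ := hb
          rw [Finset.mem_filter] at he
          have : s(e.inf, n + 2) = e := by
            have := hS e he.1
            rw [← Sym2.inf_eq_inf_and_sup_eq_sup, Sym2.inf_mk, Sym2.sup_mk]
            omega
          rw [this]
          exact hall e he.1 he.2.le
        rw [hhit]
        unfold stage
        rw [if_pos hall]
        have hw : weight α m E' (n + 1 + 1) = newWeight α m := by
          unfold weight newWeight
          rw [hE''.deg_new]
        have hsplit : potential α m (n + 2) E' (later S (n + 2)) =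
            potential α m (n + 1) E' (later S (n + 2)) *
              rising (1 - (α : ℝ)) (newWeight α m) (later S (n + 2) (n + 2)) := by
          unfold potential
          rw [Finset.prod_Icc_succ_top (by omega : 1 ≤ n + 1 + 1), hw]
        rw [hsplit, mul_comm]
        exact mul_le_mul_of_nonneg_right (rising_newWeight_le hA (later_le_card _ _ _))
          (potential_nonneg _ _ _ _ _)
      · unfold stage
        rw [if_neg hall]
        exact mul_nonneg (by positivity) (hitPotential_nonneg _ _ _ _ _ _)
    · rw [ex_smul _ _ _ (by positivity)]
      refine (mul_le_mul_right (ex_addEdges_hitPotential_le hm hn h m _ hR _) _).trans ?_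
      rw [← ENNReal.ofReal_mul (by positivity)]
      refine ENNReal.ofReal_le_ofReal ?_
      have hd : (fun b => later S (n + 2) b + if b ∈ targets S (n + 2) then 1 else 0) =
          later S (n + 1) := by
        funext b
        exact (later_eq S (n + 1) b).symm
      rw [hd, hst, hsum, ← mul_assoc]
      refine mul_le_mul_of_nonneg_right ?_ (potential_nonneg _ _ _ _ _)
      unfold stepFactor
      rw [Finset.prod_mul_distrib, Finset.prod_mul_distrib, prod_ite_one, prod_ite_one,
        prod_ite_one, ← hnew, ← card_targets, mul_comm]
      refine mul_le_mul_of_nonneg_right ?_ (by positivity)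
      refine mul_le_mul ?_ ?_ (by positivity) (by positivity)
      -- With j = m the cost per required hit is m/(2mn), which is at most 1/n.
      · refine pow_le_pow_left₀ (by positivity) ?_ _
        rw [div_le_div_iff₀ (by positivity) hnR]
        nlinarith [mul_pos hmR hnR]
      · set D := (S.filter fun e => e.inf ≤ n + 1 ∧ n + 1 < e.sup).card
        rw [← Real.exp_nat_mul]
        calc (1 + (1 - (α : ℝ)) * D / (2 * m * n)) ^ m
            ≤ (Real.exp ((1 - (α : ℝ)) * D / (2 * m * n))) ^ m := by
              refine pow_le_pow_left₀ (by positivity) ?_ _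
              rw [add_comm]
              exact Real.add_one_le_exp _
          _ = Real.exp (D * ((1 - (α : ℝ)) / 2 / n)) := by
              rw [← Real.exp_nat_mul]
              congr 1
              field_simp
  -- A missing old edge of S can never appear later, as the edges added now all have n + 2 as larger
  -- endpoint.
  · refine (ex_mono _ _ (fun _ => 0) fun E' hE' => ?_).trans ?_
    · unfold stage
      rw [if_neg]
      intro hall
      exact hold fun e he hes => mem_of_mem_support_addEdges m E' hE' e
        (hall e he (by omega)) hes
    · rw [ex_const, ENNReal.ofReal_zero]
      exact zero_le

/-! ### Telescoping over time -/

/-- A sequence of order `t ^ ((1 - α) / 2)`. -/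
noncomputable def growth (α : Set.Icc (0 : ℝ) 1) (t : ℕ) : ℝ :=
  Real.exp ((1 - (α : ℝ)) / 2 * (harmonic (t - 2) : ℝ))

theorem growth_succ (α : Set.Icc (0 : ℝ) 1) {n : ℕ} (hn : 1 ≤ n) :
    growth α (n + 2) = growth α (n + 1) * Real.exp ((1 - (α : ℝ)) / 2 / n) := by
  obtain ⟨k, rfl⟩ : ∃ k, n = k + 1 := ⟨n - 1, by omega⟩
  unfold growth
  rw [← Real.exp_add, show k + 1 + 2 - 2 = k + 1 by omega, show k + 1 + 1 - 2 = k by omega,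
    harmonic_succ]
  congr 1
  push_cast
  ring

theorem growth_pos (α : Set.Icc (0 : ℝ) 1) (t : ℕ) : 0 < growth α t := Real.exp_pos _

theorem growth_of_le_two (α : Set.Icc (0 : ℝ) 1) {t : ℕ} (ht : t ≤ 2) : growth α t = 1 := by
  unfold growth
  rw [show t - 2 = 0 by omega]
  simp

/-- The contribution of the edge `e` to the bound for the expected potential at time `t`. -/
noncomputable def edgeFactor (α : Set.Icc (0 : ℝ) 1) (A : ℝ) (t : ℕ) (e : Sym2 ℕ) : ℝ :=
  if e.inf ≤ t then
    A * (growth α (min t e.sup) / growth α e.inf) *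
      (if e.sup ≤ t then 1 / ((max (e.sup - 2) 1 : ℕ) : ℝ) else 1)
  else 1

theorem edgeFactor_nonneg (α : Set.Icc (0 : ℝ) 1) {A : ℝ} (hA : 0 ≤ A) (t : ℕ) (e : Sym2 ℕ) :
    0 ≤ edgeFactor α A t e := by
  have h1 := growth_pos α (min t e.sup)
  have h2 := growth_pos α e.inf
  unfold edgeFactor
  split_ifs <;> positivity

theorem stepFactor_nonneg (α : Set.Icc (0 : ℝ) 1) {A : ℝ} (hA : 0 ≤ A) (n : ℕ) (e : Sym2 ℕ) :
    0 ≤ stepFactor α A n e := by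
  unfold stepFactor
  refine mul_nonneg (mul_nonneg ?_ ?_) ?_ <;> split_ifs <;> positivity

/-- The position of n + 2 relative to the two endpoints decides: an edge is untouched before its
older endpoint is born, gains A at that birth, gains a growth ratio up to and including the birth of
its younger endpoint, where it also pays 1/n, and is frozen afterwards. -/
theorem stepFactor_mul_edgeFactor (α : Set.Icc (0 : ℝ) 1) (A : ℝ) {n : ℕ} (hn : 1 ≤ n)
    {e : Sym2 ℕ} (he : e.inf < e.sup) :
    stepFactor α A n e * edgeFactor α A (n + 1) e = edgeFactor α A (n + 2) e := by
  have hg : growth α (n + 2) ≠ 0 := (growth_pos α _).ne'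
  unfold stepFactor edgeFactor
  rcases le_or_gt e.sup (n + 1) with h1 | h1
  · rw [if_neg (by omega), if_neg (by omega), if_neg (by omega), if_pos (by omega),
      if_pos (by omega), if_pos (by omega), if_pos (by omega), min_eq_right h1,
      min_eq_right (by omega)]
    ring
  rcases le_or_gt e.inf (n + 1) with h2 | h2
  · rw [if_pos (⟨h2, h1⟩ : e.inf ≤ n + 1 ∧ n + 1 < e.sup), if_neg (by omega : ¬ e.inf = n + 2), if_pos h2,
      if_pos (by omega : e.inf ≤ n + 2), if_neg (by omega : ¬ e.sup ≤ n + 1),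
      min_eq_left h1.le, min_eq_left (by omega), growth_succ α hn]
    by_cases h3 : e.sup = n + 2
    · rw [if_pos h3, if_pos h3.le, h3, show n + 2 - 2 = n by omega, max_eq_left hn]
      ring
    · rw [if_neg h3, if_neg (by omega)]
      ring
  · rw [if_neg (by omega : ¬ e.sup = n + 2), if_neg (by omega), if_neg (by omega : ¬ e.inf ≤ n + 1)]
    by_cases h3 : e.inf = n + 2
    · rw [if_pos h3, if_pos h3.le, if_neg (by omega), min_eq_left (by omega), h3, div_self hg]
      ring
    · rw [if_neg h3, if_neg (by omega)]
      ring

/-- In the second graph all m edges join 1 and 2, so both vertices have degree m. The recursion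
starts here because the weight formula fails for the edges of the vertex 2. -/
theorem stage_two_le {α : Set.Icc (0 : ℝ) 1} {m : ℕ} {E : Multiset (Sym2 ℕ)}
    (h : Partial m 1 0 E) {S : Finset (Sym2 ℕ)} (hS : ∀ e ∈ S, 1 ≤ e.inf ∧ e.inf < e.sup)
    (hE : EdgesIn 2 E) {A : ℝ} (hA1 : 1 ≤ A) (hA : newWeight α m + (1 - (α : ℝ)) * S.card ≤ A) :
    stage α m S 2 E ≤ ∏ e ∈ S, edgeFactor α A 2 e := by
  have hdeg : ∀ b ∈ Finset.Icc 1 2, weight α m E b = newWeight α m := by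
    intro b hb
    have : deg E b = m := by
      unfold deg
      rw [Multiset.countP_eq_card.2, h.card_eq]
      · ring
      · intro e he
        have := hE e he
        rw [mem_iff_eq_inf_or_eq_sup]
        rw [Finset.mem_Icc] at hb
        omega
    unfold weight newWeight
    rw [this]
  have hle : stage α m S 2 E ≤ potential α m 2 E (later S 2) := by
    unfold stage
    split_ifs
    · exact le_rfl
    · exact potential_nonneg _ _ _ _ _
  refine hle.trans ?_
  unfold potential
  calc ∏ b ∈ Finset.Icc 1 2, rising (1 - (α : ℝ)) (weight α m E b) (later S 2 b)
      ≤ ∏ b ∈ Finset.Icc 1 2, A ^ later S 2 b := by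
        refine Finset.prod_le_prod (fun b _ => rising_nonneg (sub_nonneg.2 α.2.2)
          (weight_nonneg _ _ _ _) _) fun b hb => ?_
        rw [hdeg b hb]
        exact rising_newWeight_le hA (later_le_card _ _ _)
    _ = ∏ e ∈ S, (if e.inf ≤ 2 ∧ 2 < e.sup then A else 1) := by
        rw [Finset.prod_pow_eq_pow_sum, sum_later fun e he => (hS e he).1, prod_ite_one]
    _ ≤ _ := by
        refine Finset.prod_le_prod (fun e _ => by split_ifs <;> positivity) fun e he => ?_
        have := hS e he
        unfold edgeFactor
        by_cases h2 : e.inf ≤ 2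
        · rw [if_pos h2, growth_of_le_two α (min_le_left _ _), growth_of_le_two α h2]
          by_cases h3 : 2 < e.sup
          · rw [if_pos ⟨h2, h3⟩, if_neg (by omega)]
            simp
          -- For the edge {1,2} the truncated `e.sup - 2` is 0; the maximum with 1 keeps the factor
          -- equal to A.
          · rw [if_neg (by omega), if_pos (by omega), show e.sup - 2 = 0 by omega]
            simpa using hA1
        · rw [if_neg h2, if_neg (by omega)]

theorem ex_graphLaw_stage_le {α : Set.Icc (0 : ℝ) 1} {m : ℕ} (hm : 1 ≤ m) {S : Finset (Sym2 ℕ)}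
    (hS : ∀ e ∈ S, 1 ≤ e.inf ∧ e.inf < e.sup) {A : ℝ} (hA1 : 1 ≤ A)
    (hA : newWeight α m + (1 - (α : ℝ)) * S.card ≤ A) (n : ℕ) :
    ex (graphLaw α m (n + 2)) (stage α m S (n + 2)) ≤
      ENNReal.ofReal (∏ e ∈ S, edgeFactor α A (n + 2) e) := by
  induction n with
  | zero =>
    refine (ex_mono _ _ (fun _ => ∏ e ∈ S, edgeFactor α A 2 e) fun E hE => ?_).trans
      (ex_const _ _).le
    exact stage_two_le (partial_of_mem_support_graphLaw 1 E hE) hS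
      (edgesIn_of_mem_support_graphLaw 0 E hE) hA1 hA
  | succ n ih =>
    have hA0 : 0 ≤ A := zero_le_one.trans hA1
    rw [graphLaw]
    refine (ex_bind_le _ _ _ _ fun E hE => ex_addEdges_stage_le hm (by omega : 1 ≤ n + 1)
      (partial_of_mem_support_graphLaw (n + 1) E hE) hS hA1 hA).trans ?_
    rw [ex_smul _ _ _ (Finset.prod_nonneg fun e _ => stepFactor_nonneg α hA0 _ _)]
    refine (mul_le_mul_right ih _).trans ?_
    rw [← ENNReal.ofReal_mul (Finset.prod_nonneg fun e _ => stepFactor_nonneg α hA0 _ _),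
      ← Finset.prod_mul_distrib]
    refine ENNReal.ofReal_le_ofReal (le_of_eq (Finset.prod_congr rfl fun e he => ?_))
    exact stepFactor_mul_edgeFactor α A (by omega) (hS e he).2

/-- At the final time no edge is pending and all rising products are empty, so the potential is the
indicator of the event. -/
theorem stage_eq_one {α : Set.Icc (0 : ℝ) 1} {m n : ℕ} {S : Finset (Sym2 ℕ)}
    {E : Multiset (Sym2 ℕ)} (hS : ∀ e ∈ S, e.sup ≤ n) (hE : ∀ e ∈ S, e ∈ E) :
    stage α m S n E = 1 := by
  unfold stage
  rw [if_pos fun e he _ => hE e he]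
  refine Finset.prod_eq_one fun b _ => ?_
  have : later S n b = 0 := by
    unfold later
    rw [Finset.card_eq_zero, Finset.filter_eq_empty_iff]
    rintro e he ⟨-, h⟩
    exact absurd (hS e he) (by omega)
  rw [this]
  simp [rising]

/-! ### Power-law bound for the presence of an edge set -/

/-- The factor `b ^ (-(1 - α) / 2) * s ^ ((1 - α) / 2 - 1)` for an edge from `s` to `b < s`. -/
noncomputable def kernel (α : Set.Icc (0 : ℝ) 1) (e : Sym2 ℕ) : ℝ :=
  (e.inf : ℝ) ^ (-((1 - (α : ℝ)) / 2)) * (e.sup : ℝ) ^ ((1 - (α : ℝ)) / 2 - 1)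

theorem kernel_nonneg (α : Set.Icc (0 : ℝ) 1) (e : Sym2 ℕ) : 0 ≤ kernel α e := by
  unfold kernel
  positivity

theorem growth_le (α : Set.Icc (0 : ℝ) 1) {s : ℕ} (hs : 1 ≤ s) :
    growth α s ≤ Real.exp 1 * (s : ℝ) ^ ((1 - (α : ℝ)) / 2) := by
  have h0 := α.2.1
  have h1 := α.2.2
  have hsR : (0 : ℝ) < s := by exact_mod_cast hs
  rw [Real.rpow_def_of_pos hsR, ← Real.exp_add]
  unfold growth
  refine Real.exp_le_exp.2 ?_
  have hlog : Real.log ((s - 2 : ℕ) : ℝ) ≤ Real.log s := by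
    rcases Nat.eq_zero_or_pos (s - 2) with h | h
    · rw [h]
      simpa using Real.log_natCast_nonneg s
    · exact Real.log_le_log (by exact_mod_cast h) (by exact_mod_cast Nat.sub_le s 2)
  have h2 := harmonic_le_one_add_log (s - 2)
  have h3 : (1 - (α : ℝ)) / 2 * (harmonic (s - 2) : ℝ) ≤
      (1 - (α : ℝ)) / 2 * (1 + Real.log s) :=
    mul_le_mul_of_nonneg_left (by linarith) (by linarith)
  linarith

theorem le_growth (α : Set.Icc (0 : ℝ) 1) {b : ℕ} (hb : 1 ≤ b) :
    (b : ℝ) ^ ((1 - (α : ℝ)) / 2) / 2 ≤ growth α b := by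
  have h0 := α.2.1
  have h1 := α.2.2
  have hbR : (0 : ℝ) < b := by exact_mod_cast hb
  have h2 : Real.log b - Real.log 2 ≤ (harmonic (b - 2) : ℝ) := by
    rw [← Real.log_div hbR.ne' two_ne_zero]
    refine le_trans (Real.log_le_log (by positivity) ?_) (log_add_one_le_harmonic (b - 2))
    rw [div_le_iff₀ two_pos]
    -- Truncated subtraction makes this hold for b = 1 as well.
    have : b ≤ (b - 2 + 1) * 2 := by omega
    exact_mod_cast this
  have h3 : (b : ℝ) ^ ((1 - (α : ℝ)) / 2) / 2 =
      Real.exp (Real.log b * ((1 - (α : ℝ)) / 2) - Real.log 2) := by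
    rw [Real.exp_sub, Real.exp_log two_pos, ← Real.rpow_def_of_pos hbR]
  rw [h3]
  unfold growth
  refine Real.exp_le_exp.2 ?_
  have h4 := mul_le_mul_of_nonneg_left h2 (by linarith : 0 ≤ (1 - (α : ℝ)) / 2)
  have h5 : 0 < Real.log 2 := Real.log_pos one_lt_two
  nlinarith

/-- The constant 6e collects e from `growth_le`, 2 from `le_growth`, and 3 from s ≤ 3 max(s-2, 1),
which is sharp at s = 3. -/
theorem edgeFactor_le {α : Set.Icc (0 : ℝ) 1} {A : ℝ} (hA : 0 ≤ A) {n : ℕ} {e : Sym2 ℕ}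
    (h1 : 1 ≤ e.inf) (h2 : e.inf < e.sup) (h3 : e.sup ≤ n) :
    edgeFactor α A n e ≤ 6 * Real.exp 1 * A * kernel α e := by
  have hb : (0 : ℝ) < e.inf := by exact_mod_cast h1
  have hs : (0 : ℝ) < e.sup := by exact_mod_cast (by omega : 0 < e.sup)
  unfold edgeFactor kernel
  rw [if_pos (by omega), if_pos h3, min_eq_right h3, Real.rpow_neg hb.le,
    Real.rpow_sub_one hs.ne']
  set β := (1 - (α : ℝ)) / 2
  have hbβ : 0 < (e.inf : ℝ) ^ β := Real.rpow_pos_of_pos hb _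
  have hsβ : 0 < (e.sup : ℝ) ^ β := Real.rpow_pos_of_pos hs _
  have h4 : growth α e.sup / growth α e.inf ≤
      Real.exp 1 * (e.sup : ℝ) ^ β / ((e.inf : ℝ) ^ β / 2) :=
    div_le_div₀ (by positivity) (growth_le α (by omega)) (by positivity) (le_growth α h1)
  have h5 : 1 / ((max (e.sup - 2) 1 : ℕ) : ℝ) ≤ 3 / e.sup := by
    rw [div_le_div_iff₀ (by exact_mod_cast (by omega : 0 < max (e.sup - 2) 1)) hs]
    exact_mod_cast (by omega : 1 * e.sup ≤ 3 * max (e.sup - 2) 1)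
  have h6 := growth_pos α e.sup
  have h7 := growth_pos α e.inf
  calc A * (growth α e.sup / growth α e.inf) * (1 / ((max (e.sup - 2) 1 : ℕ) : ℝ))
      ≤ A * (Real.exp 1 * (e.sup : ℝ) ^ β / ((e.inf : ℝ) ^ β / 2)) * (3 / e.sup) := by gcongr
    _ = _ := by
      field_simp
      ring

theorem toOuterMeasure_subset_le {α : Set.Icc (0 : ℝ) 1} {m : ℕ} (hm : 1 ≤ m)
    {S : Finset (Sym2 ℕ)} {n : ℕ} (hn : 2 ≤ n)
    (hS : ∀ e ∈ S, 1 ≤ e.inf ∧ e.inf < e.sup ∧ e.sup ≤ n) {A : ℝ} (hA1 : 1 ≤ A)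
    (hA : newWeight α m + (1 - (α : ℝ)) * S.card ≤ A) :
    (graphLaw α m n).toOuterMeasure {E | ∀ e ∈ S, e ∈ E} ≤
      ENNReal.ofReal (∏ e ∈ S, 6 * Real.exp 1 * A * kernel α e) := by
  obtain ⟨k, rfl⟩ : ∃ k, n = k + 2 := ⟨n - 2, by omega⟩
  have hA0 : 0 ≤ A := zero_le_one.trans hA1
  refine (toOuterMeasure_le_ex _ _ (stage α m S (k + 2)) fun E hE _ =>
    (stage_eq_one (fun e he => (hS e he).2.2) hE).ge).trans ?_
  refine (ex_graphLaw_stage_le hm (fun e he => ⟨(hS e he).1, (hS e he).2.1⟩) hA1 hA k).trans ?_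
  refine ENNReal.ofReal_le_ofReal (Finset.prod_le_prod (fun e _ => edgeFactor_nonneg α hA0 _ _)
    fun e he => edgeFactor_le hA0 (hS e he).1 (hS e he).2.1 (hS e he).2.2)

/-! ### Union bound over trails -/

/-- All edges of `S` are present, and there is a trail of length `l` from `v` to `w` which avoids
them. -/
def trailEvent (S : Finset (Sym2 ℕ)) (l v w : ℕ) : Set (Multiset (Sym2 ℕ)) :=
  {E | (∀ e ∈ S, e ∈ E) ∧ ∃ p : (SimpleGraph.fromEdgeSet {e : Sym2 ℕ | e ∈ E}).Walk v w,
    p.IsTrail ∧ p.length = l ∧ ∀ e ∈ S, e ∉ p.edges}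

/-- The sum over all sequences of `l` steps in `[n]` from a vertex to `w` of the product of the
kernels of the steps. -/
noncomputable def pathSum (α : Set.Icc (0 : ℝ) 1) (n w : ℕ) : ℕ → ℕ → ℝ
  | 0, v => if v = w then 1 else 0
  | l + 1, v => ∑ x ∈ Finset.Icc 1 n, kernel α s(v, x) * pathSum α n w l x

theorem pathSum_nonneg (α : Set.Icc (0 : ℝ) 1) (n w l v : ℕ) : 0 ≤ pathSum α n w l v := by
  induction l generalizing v with
  | zero =>
    unfold pathSum
    split_ifs <;> norm_num
  | succ l ih => exact Finset.sum_nonneg fun x _ => mul_nonneg (kernel_nonneg _ _) (ih x)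

theorem trailEvent_succ_subset {S : Finset (Sym2 ℕ)} {l v w n : ℕ} {E : Multiset (Sym2 ℕ)}
    (hE : EdgesIn n E) (h : E ∈ trailEvent S (l + 1) v w) :
    ∃ x ∈ Finset.Icc 1 n, x ≠ v ∧ s(v, x) ∉ S ∧ E ∈ trailEvent (insert s(v, x) S) l x w := by
  obtain ⟨h1, p, h2, h3, h4⟩ := h
  cases p with
  | nil => simp at h3
  | @cons _ x _ hadj q =>
    obtain ⟨h5, h6⟩ := (SimpleGraph.fromEdgeSet_adj _).1 hadj
    rw [SimpleGraph.Walk.isTrail_cons] at h2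
    rw [SimpleGraph.Walk.length_cons, Nat.add_right_cancel_iff] at h3
    simp only [SimpleGraph.Walk.edges_cons, List.mem_cons, not_or] at h4
    have h7 := hE _ h5
    rw [Sym2.inf_mk, Sym2.sup_mk] at h7
    refine ⟨x, Finset.mem_Icc.2 (by omega), Ne.symm h6, fun h8 => (h4 _ h8).1 rfl, ?_, q, h2.1, h3, ?_⟩
    · intro e he
      rcases Finset.mem_insert.1 he with rfl | he
      · exact h5
      · exact h1 e he
    · intro e he
      rcases Finset.mem_insert.1 he with rfl | he
      · exact h2.2
      · exact (h4 e he).2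

/-- The trail is revealed edge by edge and the revealed edges move into S. Trails suffice in place
of paths: distinct edges are all that the bound for edge sets needs, and the tail of a trail is
again a trail avoiding S. The budget L keeps A fixed during the induction. -/
theorem toOuterMeasure_trailEvent_le {α : Set.Icc (0 : ℝ) 1} {m : ℕ} (hm : 1 ≤ m) {n L : ℕ}
    (hn : 2 ≤ n) {A : ℝ} (hA1 : 1 ≤ A) (hA : newWeight α m + (1 - (α : ℝ)) * L ≤ A) (w l : ℕ) :
    ∀ (S : Finset (Sym2 ℕ)) (v : ℕ), S.card + l ≤ L → 1 ≤ v → v ≤ n →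
      (∀ e ∈ S, 1 ≤ e.inf ∧ e.inf < e.sup ∧ e.sup ≤ n) →
      (graphLaw α m n).toOuterMeasure (trailEvent S l v w) ≤
        ENNReal.ofReal ((6 * Real.exp 1 * A) ^ (S.card + l) * (∏ e ∈ S, kernel α e) *
          pathSum α n w l v) := by
  have hA0 : 0 ≤ A := zero_le_one.trans hA1
  have hc : (0 : ℝ) ≤ 1 - (α : ℝ) := sub_nonneg.2 α.2.2
  induction l with
  | zero =>
    intro S v hL _ _ hS
    by_cases hvw : v = w
    · unfold pathSum
      rw [if_pos hvw, mul_one, Nat.add_zero, ← Finset.prod_const, ← Finset.prod_mul_distrib]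
      have hL' : (S.card : ℝ) ≤ L := by exact_mod_cast hL
      refine ((graphLaw α m n).toOuterMeasure.mono fun E hE => hE.1).trans
        (toOuterMeasure_subset_le hm hn hS hA1 (le_trans ?_ hA))
      gcongr
    · have : trailEvent S 0 v w = ∅ := by
        rw [Set.eq_empty_iff_forall_notMem]
        rintro E ⟨-, p, -, hp, -⟩
        exact hvw (SimpleGraph.Walk.eq_of_length_eq_zero hp)
      rw [this, MeasureTheory.measure_empty]
      exact zero_le
  | succ l ih =>
    intro S v hL hv1 hvn hS
    -- Restricting to the support confines the next vertex x to [n], which makes the union finite.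
    have hsub : trailEvent S (l + 1) v w ∩ (graphLaw α m n).support ⊆
        ⋃ x ∈ (Finset.Icc 1 n).filter (fun x => x ≠ v ∧ s(v, x) ∉ S),
          trailEvent (insert s(v, x) S) l x w := by
      rintro E ⟨h1, h2⟩
      obtain ⟨k, rfl⟩ : ∃ k, n = k + 2 := ⟨n - 2, by omega⟩
      obtain ⟨x, hx, hxv, hxS, hxE⟩ :=
        trailEvent_succ_subset (edgesIn_of_mem_support_graphLaw k E h2) h1
      exact Set.mem_biUnion (Finset.mem_coe.2 (Finset.mem_filter.2 ⟨hx, hxv, hxS⟩)) hxE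
    refine (PMF.toOuterMeasure_mono _ hsub).trans ?_
    refine (MeasureTheory.measure_biUnion_finset_le _ _).trans ?_
    have hterm : ∀ x ∈ (Finset.Icc 1 n).filter (fun x => x ≠ v ∧ s(v, x) ∉ S),
        (graphLaw α m n).toOuterMeasure (trailEvent (insert s(v, x) S) l x w) ≤
        ENNReal.ofReal ((6 * Real.exp 1 * A) ^ (S.card + (l + 1)) * (∏ e ∈ S, kernel α e) *
          (kernel α s(v, x) * pathSum α n w l x)) := by
      intro x hx
      obtain ⟨hx1, hxv, hxS⟩ := Finset.mem_filter.1 hx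
      rw [Finset.mem_Icc] at hx1
      have hcard : (insert s(v, x) S).card = S.card + 1 := Finset.card_insert_of_notMem hxS
      refine (ih (insert s(v, x) S) x (by omega) hx1.1 hx1.2 ?_).trans (le_of_eq ?_)
      · intro e he
        rcases Finset.mem_insert.1 he with rfl | he
        · rw [Sym2.inf_mk, Sym2.sup_mk]
          omega
        · exact hS e he
      · rw [hcard, Finset.prod_insert hxS]
        congr 1
        ring
    refine (Finset.sum_le_sum hterm).trans ?_
    have hnn : ∀ x, 0 ≤ (6 * Real.exp 1 * A) ^ (S.card + (l + 1)) * (∏ e ∈ S, kernel α e) *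
        (kernel α s(v, x) * pathSum α n w l x) := fun x =>
      mul_nonneg (mul_nonneg (by positivity) (Finset.prod_nonneg fun e _ => kernel_nonneg α e))
        (mul_nonneg (kernel_nonneg _ _) (pathSum_nonneg _ _ _ _ _))
    rw [← ENNReal.ofReal_sum_of_nonneg fun x _ => hnn x]
    refine ENNReal.ofReal_le_ofReal ?_
    rw [pathSum, Finset.mul_sum]
    exact Finset.sum_le_sum_of_subset_of_nonneg (Finset.filter_subset _ _) fun x _ _ => hnn x

/-! ### Summing the kernels -/

/-- Equality holds for v ≤ x. For x ≤ v the left side is v^(β-1) x^(1-2β) / x, and 2β = 1 - α ≤ 1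
allows replacing x by v in the middle power. -/
theorem kernel_mul_rpow_le (α : Set.Icc (0 : ℝ) 1) {v x : ℕ} (hv : 1 ≤ v) (hx : 1 ≤ x) :
    kernel α s(v, x) * (x : ℝ) ^ (-((1 - (α : ℝ)) / 2)) ≤
      (v : ℝ) ^ (-((1 - (α : ℝ)) / 2)) * (x : ℝ)⁻¹ := by
  have h0 := α.2.1
  have hvR : (0 : ℝ) < v := by exact_mod_cast hv
  have hxR : (0 : ℝ) < x := by exact_mod_cast hx
  unfold kernel
  rw [Sym2.inf_mk, Sym2.sup_mk]
  set β := (1 - (α : ℝ)) / 2 with hβ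
  rcases le_total v x with h | h
  · rw [inf_eq_left.2 h, sup_eq_right.2 h, mul_assoc, ← Real.rpow_add hxR, ← Real.rpow_neg_one]
    refine le_of_eq ?_
    congr 2
    ring
  · rw [inf_eq_right.2 h, sup_eq_left.2 h, mul_right_comm, ← Real.rpow_add hxR]
    have h1 : (x : ℝ) ^ (-β + -β) = (x : ℝ) ^ (1 - 2 * β) * (x : ℝ)⁻¹ := by
      rw [← Real.rpow_neg_one, ← Real.rpow_add hxR]
      congr 1
      ring
    have h2 : (x : ℝ) ^ (1 - 2 * β) ≤ (v : ℝ) ^ (1 - 2 * β) :=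
      Real.rpow_le_rpow hxR.le (by exact_mod_cast h) (by rw [hβ]; linarith)
    calc (x : ℝ) ^ (-β + -β) * (v : ℝ) ^ (β - 1)
        ≤ (v : ℝ) ^ (1 - 2 * β) * (x : ℝ)⁻¹ * (v : ℝ) ^ (β - 1) := by
          rw [h1]
          gcongr
      _ = (v : ℝ) ^ ((1 - 2 * β) + (β - 1)) * (x : ℝ)⁻¹ := by
          rw [Real.rpow_add hvR]
          ring
      _ = _ := by
          congr 2
          ring

/-- The profile v^(-β) is reproduced by one more step, up to a harmonic sum over the new
intermediate vertex. -/
theorem pathSum_le (α : Set.Icc (0 : ℝ) 1) {n : ℕ} (l : ℕ) : ∀ v : ℕ, 1 ≤ v → v ≤ n →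
    pathSum α n n (l + 1) v ≤ (1 + Real.log n) ^ l *
      ((v : ℝ) ^ (-((1 - (α : ℝ)) / 2)) * (n : ℝ) ^ ((1 - (α : ℝ)) / 2 - 1)) := by
  induction l with
  | zero =>
    intro v hv hvn
    have h1 : pathSum α n n 1 v = kernel α s(v, n) := by
      simp only [pathSum, mul_ite, mul_one, mul_zero]
      rw [Finset.sum_ite_eq' (Finset.Icc 1 n) n (fun x => kernel α s(v, x)),
        if_pos (Finset.mem_Icc.2 ⟨hv.trans hvn, le_rfl⟩)]
    rw [h1, pow_zero, one_mul]
    unfold kernel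
    rw [Sym2.inf_mk, Sym2.sup_mk, inf_eq_left.2 hvn, sup_eq_right.2 hvn]
  | succ l ih =>
    intro v hv hvn
    have hlog : 0 ≤ 1 + Real.log n := by
      have := Real.log_natCast_nonneg n
      linarith
    rw [pathSum]
    have hterm : ∀ x ∈ Finset.Icc 1 n, kernel α s(v, x) * pathSum α n n (l + 1) x ≤
        (1 + Real.log n) ^ l * ((v : ℝ) ^ (-((1 - (α : ℝ)) / 2)) *
          (n : ℝ) ^ ((1 - (α : ℝ)) / 2 - 1)) * (x : ℝ)⁻¹ := by
      intro x hx
      rw [Finset.mem_Icc] at hx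
      have h1 := mul_le_mul_of_nonneg_left (ih x hx.1 hx.2) (kernel_nonneg α s(v, x))
      have h2 := mul_le_mul_of_nonneg_left (kernel_mul_rpow_le α hv hx.1)
        (by positivity : 0 ≤ (1 + Real.log n) ^ l * (n : ℝ) ^ ((1 - (α : ℝ)) / 2 - 1))
      linarith
    refine (Finset.sum_le_sum hterm).trans ?_
    rw [← Finset.mul_sum]
    have hh : ∑ x ∈ Finset.Icc 1 n, (x : ℝ)⁻¹ ≤ 1 + Real.log n := by
      refine le_trans (le_of_eq ?_) (harmonic_le_one_add_log n)
      rw [harmonic_eq_sum_Icc]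
      push_cast
      rfl
    refine (mul_le_mul_of_nonneg_left hh (by positivity)).trans (le_of_eq ?_)
    ring

/-! ### The exponent and the final bound -/

theorem chi_eq (α : Set.Icc (0 : ℝ) 1) : chi α = 1 - (1 - (α : ℝ)) / 2 := by
  unfold chi
  split_ifs with h
  · rw [h]
    norm_num
  · have h1 : 1 - (α : ℝ) ≠ 0 := sub_ne_zero.2 (Ne.symm h)
    field_simp
    ring

theorem not_joined_self {E : Multiset (Sym2 ℕ)} {l v : ℕ} (hl : 1 ≤ l) : ¬ Joined E l v v := by
  rintro ⟨p, hp, hpl⟩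
  rw [SimpleGraph.Walk.isPath_iff_nil, ← SimpleGraph.Walk.length_eq_zero_iff] at hp
  omega

end SeqPA

theorem lemma4p9 (α : Set.Icc (0 : ℝ) 1) (m : ℕ) (hm : 1 ≤ m) (l : ℕ) (hl : 1 ≤ l) :
    ∃ C : ℝ, ∀ n v : ℕ, 1 ≤ v → v ≤ n →
      ((SeqPA.graphLaw α m n).toOuterMeasure {E | SeqPA.Joined E l v n}).toReal ≤
        C * (Real.log n) ^ l / (n : ℝ) ^ SeqPA.chi α := by
  have hc : (0 : ℝ) ≤ 1 - (α : ℝ) := sub_nonneg.2 α.2.2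
  set A : ℝ := SeqPA.newWeight α m + (1 - (α : ℝ)) * l + 1 with hA
  have hw := SeqPA.newWeight_nonneg α m
  have hA1 : 1 ≤ A := by
    have : 0 ≤ (1 - (α : ℝ)) * l := by positivity
    linarith
  -- Chosen so that 1 + log n ≤ D log n for all n ≥ 2.
  set D : ℝ := 1 + 1 / Real.log 2 with hD
  have hlog2 : 0 < Real.log 2 := Real.log_pos one_lt_two
  refine ⟨(6 * Real.exp 1 * A) ^ l * D ^ l, fun n v hv hvn => ?_⟩
  rcases (by omega : n = 1 ∨ 2 ≤ n) with rfl | hn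
  · obtain rfl : v = 1 := by omega
    have : {E | SeqPA.Joined E l 1 1} = ∅ :=
      Set.eq_empty_iff_forall_notMem.2 fun E => SeqPA.not_joined_self hl
    rw [this, MeasureTheory.measure_empty, ENNReal.toReal_zero]
    positivity
  have hlogn : Real.log 2 ≤ Real.log n := Real.log_le_log two_pos (by exact_mod_cast hn)
  have hDlog : 1 + Real.log n ≤ D * Real.log n := by
    have : 1 ≤ 1 / Real.log 2 * Real.log n := by
      rw [one_div, ← div_eq_inv_mul, le_div_iff₀ hlog2]
      linarith
    rw [hD]
    linarith
  obtain ⟨k, rfl⟩ : ∃ k, l = k + 1 := ⟨l - 1, by omega⟩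
  have h1 := SeqPA.toOuterMeasure_trailEvent_le hm hn (L := k + 1) hA1 (by linarith) n (k + 1) ∅ v
    (by simp) hv hvn (by simp)
  have h2 : {E | SeqPA.Joined E (k + 1) v n} ⊆ SeqPA.trailEvent ∅ (k + 1) v n := by
    rintro E ⟨p, hp, hpl⟩
    exact ⟨by simp, p, hp.isTrail, hpl, by simp⟩
  have h3 := ((SeqPA.graphLaw α m n).toOuterMeasure.mono h2).trans h1
  refine ENNReal.toReal_le_of_le_ofReal (by positivity) (h3.trans (ENNReal.ofReal_le_ofReal ?_))
  rw [Finset.card_empty, zero_add, Finset.prod_empty, mul_one]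
  have hnR : (0 : ℝ) < n := by exact_mod_cast (by omega : 0 < n)
  have hv1 : (v : ℝ) ^ (-((1 - (α : ℝ)) / 2)) ≤ 1 :=
    Real.rpow_le_one_of_one_le_of_nonpos (by exact_mod_cast hv) (by linarith)
  have hchi : (n : ℝ) ^ ((1 - (α : ℝ)) / 2 - 1) = 1 / (n : ℝ) ^ SeqPA.chi α := by
    rw [SeqPA.chi_eq, one_div, ← Real.rpow_neg hnR.le, neg_sub]
  calc (6 * Real.exp 1 * A) ^ (k + 1) * SeqPA.pathSum α n n (k + 1) v
      ≤ (6 * Real.exp 1 * A) ^ (k + 1) * ((1 + Real.log n) ^ k *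
        ((v : ℝ) ^ (-((1 - (α : ℝ)) / 2)) * (n : ℝ) ^ ((1 - (α : ℝ)) / 2 - 1))) := by
        gcongr
        exact SeqPA.pathSum_le α k v hv hvn
    _ ≤ (6 * Real.exp 1 * A) ^ (k + 1) * ((D * Real.log n) ^ (k + 1) *
        (1 * (n : ℝ) ^ ((1 - (α : ℝ)) / 2 - 1))) := by
        gcongr
        -- The path sum has only l - 1 logarithms; one more is given away to reach the stated power.
        refine (pow_le_pow_right₀ (by linarith) (Nat.le_succ k)).trans ?_
        gcongr
    _ = _ := by
        rw [hchi, mul_pow]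
        ring_nf
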